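/- Let $\mathbb{T}=\mathbb{R}/\mathbb{Z}$ and identify $\mathbb{F}_2$ with the subgroup $\{0,1/2\}$ of $\mathbb{T}$ via $0\mapsto 0$, $1\mapsto 1/2$. A non-classical polynomial in $n$ variables is a function $P:\mathbb{F}_2^n\to\mathbb{T}$ of the form $$P(x_1,\dots,x_n)=\alpha+\sum_{\emptyset\ne S\subseteq\{1,\dots,n\},\ k\ge 1}\frac{c_{S,k}\prod_{i\in S}x_i}{2^k} \pmod 1,$$ where $\alpha\in\mathbb{T}$ (the shift), $c_{S,k}\in\{0,1\}$, only finitely many $c_{S,k}$ are nonzero, and each $x_i$ is read as an integer in $\{0,1\}$. Its degree is the largest $|S|+k-1$, and its depth the largest $k$, over all $(S,k)$ with $c_{S,k}\neq 0$ (both are $0$ if there are none). It is classical if its depth is at most $1$ and $\alpha\in\{0,1/2\}$; classical polynomials are exactly the $\{0,1/2\}$-valued functions given by polynomials over $\mathbb{F}_2$. For $t\ge 1$ let $S_t:\mathbb{F}_2^n\to\{0,1/2\}$ be the Boolean function given by the elementary symmetric polynomial of degree $t$ over $\mathbb{F}_2$ in $n$ variables. Theorem. Fix any integer $\ell\ge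 4$. Then there is an integer $d\ge 1$, independent of $n$, such that the following two statements hold. 1. There is a function $\varepsilon:\mathbb{N}\to\mathbb{R}$ with $\varepsilon(n)\to 0$ as $n\to\infty$ such that, for every $n\ge 1$ and every classical polynomial $P$ in $n$ variables of degree at most $d$, $$\Pr_{x\sim\mathbb{F}_2^n}[S_{2^\ell}(x)=P(x)]\le \tfrac12+\varepsilon(n).$$ 2. There is a constant $c>0$ such that, for all sufficiently large $n$, there is a non-classical polynomial $P'$ in $n$ variables of degree at most $d$, whose shift is of the form $A/2^{k}$ with $k$ the depth of $P'$ and $A\in\{0,\dots,2^k-1\}$, satisfying $$\Pr_{x\sim\mathbb{F}_2^n}[S_{2^\ell}(x)=P'(x)]\ge \tfrac12+c.$$ Here $x$ is uniformly distributed over $\mathbb{F}_2^n$. -/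

import Mathlib

open Filter Topology

noncomputable section

/-- The agreement of two functions on a finite domain: the fraction of inputs on which they
coincide. -/
def agr {D R : Type*} [Fintype D] (F G : D → R) : ℝ :=
  open Classical in
  ((Finset.univ.filter fun x => F x = G x).card : ℝ) / (Fintype.card D : ℝ)

/-- The identification of `𝔽₂` with the subgroup `{0, 1/2}` of the torus `ℝ/ℤ`. -/
def toTorus (a : ZMod 2) : UnitAddCircle :=
  (((a.val : ℝ) / 2 : ℝ) : UnitAddCircle)

/-- The elementary symmetric polynomial of degree `t` over `𝔽₂` in `n` variables, as a Boolean
function with values in `{0, 1/2} ⊆ ℝ/ℤ`. -/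
def elemSym (n t : ℕ) (x : Fin n → ZMod 2) : UnitAddCircle :=
  toTorus (MvPolynomial.eval x (MvPolynomial.esymm (Fin n) (ZMod 2) t))

/-- A non-classical polynomial in `n` variables over `𝔽₂`, in the normal form
`α + ∑ c_{S,k} (∏_{i ∈ S} x_i) / 2 ^ k (mod 1)`, over nonempty sets `S` of variables and `k ≥ 1`,
with `c_{S,k} ∈ {0, 1}`. The set `S` collects the variables of exponent `1`, and `terms` is the
finite set of pairs `(S, k)` with `c_{S,k} = 1`. -/
structure NonclassicalPolynomial (n : ℕ) where
  shift : UnitAddCircle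
  terms : Finset (Finset (Fin n) × ℕ)
  nonempty_of_mem : ∀ t ∈ terms, t.1.Nonempty
  one_le_of_mem : ∀ t ∈ terms, 1 ≤ t.2

namespace NonclassicalPolynomial

/-- The function `𝔽₂ⁿ → ℝ/ℤ` given by a non-classical polynomial; the coordinates are lifted to
`{0, 1} ⊆ ℝ`. -/
def eval {n : ℕ} (P : NonclassicalPolynomial n) (x : Fin n → ZMod 2) : UnitAddCircle :=
  P.shift + ∑ t ∈ P.terms,
    (((∏ i ∈ t.1, ((x i).val : ℝ)) / 2 ^ t.2 : ℝ) : UnitAddCircle)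

/-- The degree: the largest `|S| + (k - 1)` over the terms present (`0` for constants). -/
def degree {n : ℕ} (P : NonclassicalPolynomial n) : ℕ :=
  P.terms.sup fun t => t.1.card + (t.2 - 1)

/-- The depth: the largest `k` over the terms present (`0` for constants). -/
def depth {n : ℕ} (P : NonclassicalPolynomial n) : ℕ :=
  P.terms.sup fun t => t.2

/-- The shift is `A / 2 ^ k` with `k` the depth and `A ∈ {0, …, 2 ^ k - 1}`. -/
def HasDyadicShift {n : ℕ} (P : NonclassicalPolynomial n) : Prop :=
  ∃ A : ℕ, A < 2 ^ P.depth ∧ P.shift = (((A : ℝ) / 2 ^ P.depth : ℝ) : UnitAddCircle)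

/-- Classical polynomials: shift in `{0, 1/2}` and depth at most `1` (depth `0` being the
constants `0` and `1/2`). -/
def IsClassical {n : ℕ} (P : NonclassicalPolynomial n) : Prop :=
  (P.shift = toTorus 0 ∨ P.shift = toTorus 1) ∧ P.depth ≤ 1

end NonclassicalPolynomial

end

-- At a point of weight w the function S_{2^ℓ} is the parity of C(w, 2^ℓ). The two statements hold
-- for different reasons, and the degree d = 12·2^(ℓ-4) + 2 serves both.
--
-- Classical bound, valid for every d < 2^ℓ. The sum of S_{2^ℓ} and a classical P of degree at most
-- d is a polynomial over 𝔽₂ whose parts of degree above d are symmetric. A Ramsey argument lowers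
-- this threshold one degree at a time (`exists_bias_le`). In enough variables there is a large set
-- T on which the coefficients of the threshold degree are constant. Fixing the variables outside T
-- keeps the top part equal to e_{2^ℓ} and makes one more homogeneous part symmetric. A bias bound
-- on every fibre averages to one on the cube. In the end the polynomial depends only on the weight.
-- By Frobenius a weight shift of 2^ℓ negates its sign (`sum_choose_mul_add_two_pow`), while the
-- binomial distribution is almost invariant under bounded shifts
-- (`abs_sum_choose_mul_shift_sub_le`). So the bias tends to 0.
--
-- Non-classical gain. Put b = 2^(ℓ-4) and take e_{12b}/8, of degree at most 12b + 2 < 16b = 2^ℓ.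
-- Modulo 8, C(w, 12b) and C(w, 16b) equal C(u, 12) and C(u, 16) with u = ⌊w/b⌋
-- (`choose_two_pow_mul_modEq`), so everything reduces to ℓ = 4. There the agreement of C(u, 12)/8
-- with C(u, 16)/2 modulo 1 has period 64 in u and holds for 36 of the 64 residues. As 36/64 = 1/2 +
-- 1/16, shift invariance of the binomial distribution leaves a constant advantage.

universe u

/-! ### Ramsey's theorem for uniform hypergraphs -/

/-- Ramsey's theorem for `k`-uniform hypergraphs and two colours. -/
theorem exists_ramsey_uniform (k : ℕ) :
    ∀ a b : ℕ, ∃ N : ℕ, ∀ {α : Type u} [DecidableEq α] (V : Finset α), N ≤ V.card →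
      ∀ c : Finset α → Prop,
      (∃ T ⊆ V, T.card = a ∧ ∀ K ⊆ T, K.card = k → c K) ∨
      (∃ T ⊆ V, T.card = b ∧ ∀ K ⊆ T, K.card = k → ¬ c K) := by
  induction k with
  | zero =>
    intro a b
    refine ⟨max a b, fun {α} _ V hV c => ?_⟩
    by_cases h : c ∅
    · obtain ⟨T, hT, hc⟩ := Finset.exists_subset_card_eq (le_trans (le_max_left a b) hV)
      exact Or.inl ⟨T, hT, hc, fun K _ hK => by rwa [Finset.card_eq_zero.mp hK]⟩
    · obtain ⟨T, hT, hc⟩ := Finset.exists_subset_card_eq (le_trans (le_max_right a b) hV)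
      exact Or.inr ⟨T, hT, hc, fun K _ hK => by rwa [Finset.card_eq_zero.mp hK]⟩
  | succ k ih =>
    have hempty : ∀ {α : Type u} (K : Finset α), K ⊆ ∅ → K.card ≠ k + 1 := fun K hK => by
      simp [Finset.subset_empty.mp hK]
    have hinsert : ∀ {α : Type u} [DecidableEq α] (c : Finset α → Prop) (v : α)
        (W T : Finset α), T ⊆ W →
        (∀ K ⊆ W, K.card = k → c (insert v K)) → (∀ K ⊆ T, K.card = k + 1 → c K) →
        ∀ K ⊆ insert v T, K.card = k + 1 → c K := by
      intro α _ c v W T hTW hW hT K hK hKc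
      by_cases hv : v ∈ K
      · have := hW (K.erase v) ((Finset.subset_insert_iff.mp hK).trans hTW)
          (by rw [Finset.card_erase_of_mem hv, hKc, Nat.add_sub_cancel])
        rwa [Finset.insert_erase hv] at this
      · exact hT K ((Finset.subset_insert_iff_of_notMem hv).mp hK) hKc
    intro a
    induction a with
    | zero =>
      exact fun b => ⟨0, fun {α} _ V _ c =>
        Or.inl ⟨∅, by simp, rfl, fun K hK hc => absurd hc (hempty K hK)⟩⟩
    | succ a iha =>
      intro b
      induction b with
      | zero =>
        exact ⟨0, fun {α} _ V _ c =>
          Or.inr ⟨∅, by simp, rfl, fun K hK hc => absurd hc (hempty K hK)⟩⟩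
      | succ b ihb =>
        -- The k-sets avoiding a vertex v are coloured by c (insert v K). Inside a set homogeneous
        -- for this link colouring, either a smaller c-homogeneous set of the matching colour is
        -- extended by v, or one of the other colour already has full size.
        obtain ⟨N₁, h₁⟩ := iha (b + 1)
        obtain ⟨N₂, h₂⟩ := ihb
        obtain ⟨N, hN⟩ := ih N₁ N₂
        refine ⟨N + 1, fun {α} _ V hV c => ?_⟩
        obtain ⟨v, hv⟩ : V.Nonempty := Finset.card_pos.mp (by omega)
        have hcard : N ≤ (V.erase v).card := by rw [Finset.card_erase_of_mem hv]; omega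
        have hVe : V.erase v ⊆ V := Finset.erase_subset v V
        have hnot : ∀ {W T : Finset α}, W ⊆ V.erase v → T ⊆ W → v ∉ T :=
          fun hW hT h => Finset.notMem_erase v V (hW (hT h))
        rcases hN (V.erase v) hcard (fun K => c (insert v K)) with
          ⟨W, hWV, hWc, hW⟩ | ⟨W, hWV, hWc, hW⟩
        · rcases h₁ W hWc.ge c with ⟨T, hT, hTc, h⟩ | ⟨T, hT, hTc, h⟩
          · refine Or.inl ⟨insert v T, Finset.insert_subset hv ((hT.trans hWV).trans hVe), ?_,
              hinsert c v W T hT hW h⟩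
            rw [Finset.card_insert_of_notMem (hnot hWV hT), hTc]
          · exact Or.inr ⟨T, (hT.trans hWV).trans hVe, hTc, h⟩
        · rcases h₂ W hWc.ge c with ⟨T, hT, hTc, h⟩ | ⟨T, hT, hTc, h⟩
          · exact Or.inl ⟨T, (hT.trans hWV).trans hVe, hTc, h⟩
          · refine Or.inr ⟨insert v T, Finset.insert_subset hv ((hT.trans hWV).trans hVe), ?_,
              hinsert (fun K => ¬ c K) v W T hT hW h⟩
            rw [Finset.card_insert_of_notMem (hnot hWV hT), hTc]

/-! ### Near shift invariance of the binomial distribution -/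

/-- This is the variance of a symmetric binomial variable, read off from the Bernstein variance
identity at 1/2. -/
theorem sum_choose_mul_sub_sq (N : ℕ) :
    ∑ m ∈ Finset.range (N + 1), (N.choose m : ℝ) * (2 * m - N) ^ 2 = (2 : ℝ) ^ N * N := by
  have h := congrArg (Polynomial.eval (1 / 2 : ℝ)) (bernsteinPolynomial.variance ℝ N)
  simp only [bernsteinPolynomial, Polynomial.eval_finsetSum, Polynomial.eval_mul,
    Polynomial.eval_pow, Polynomial.eval_sub, Polynomial.eval_X,
    Polynomial.eval_natCast, Polynomial.eval_one, nsmul_eq_mul] at h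
  have h' : ∀ m ∈ Finset.range (N + 1), (N.choose m : ℝ) * (2 * m - N) ^ 2 =
      4 * 2 ^ N * (((N : ℝ) * (1 / 2) - m) ^ 2 *
        (N.choose m * (1 / 2) ^ m * (1 - 1 / 2) ^ (N - m))) := by
    intro m hm
    have hm' : m ≤ N := by simpa [Nat.lt_succ_iff] using hm
    have : (2 : ℝ) ^ N * ((1 / 2) ^ m * (1 - 1 / 2) ^ (N - m)) = 1 := by
      rw [show (1 - 1 / 2 : ℝ) = 1 / 2 by norm_num, ← pow_add, Nat.add_sub_cancel' hm', ← mul_pow]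
      norm_num
    linear_combination (-(N.choose m : ℝ) * (2 * m - N) ^ 2) * this
  rw [Finset.sum_congr rfl h', ← Finset.mul_sum, h]
  ring

/-- The binomial distribution is nearly invariant under a unit shift. -/
theorem abs_sum_choose_mul_shift_sub_le (n : ℕ) (φ : ℕ → ℝ) (hφ : ∀ m, |φ m| ≤ 1) :
    |∑ m ∈ Finset.range (n + 1), (n.choose m : ℝ) * (φ (m + 1) - φ m)| ≤
      2 / √(n + 1) * 2 ^ n := by
  set s : ℝ := √(n + 1) with hs
  have hspos : 0 < s := Real.sqrt_pos.mpr (by positivity)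
  have hss : s * s = n + 1 := Real.mul_self_sqrt (by positivity)
  -- Summation by parts: (n+1)·C(n, m) equals both (m+1)·C(n+1, m+1) and (n+1-m)·C(n+1, m), so the
  -- difference becomes a first-moment sum over n + 1 coins.
  have key : (n + 1 : ℝ) * ∑ m ∈ Finset.range (n + 1), (n.choose m : ℝ) * (φ (m + 1) - φ m) =
      ∑ m ∈ Finset.range (n + 1 + 1), ((n + 1).choose m : ℝ) * (2 * m - (n + 1 : ℕ)) * φ m := by
    have e₁ : ∑ m ∈ Finset.range (n + 1 + 1), ((n + 1).choose m : ℝ) * m * φ m =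
        ∑ m ∈ Finset.range (n + 1), (n + 1 : ℝ) * n.choose m * φ (m + 1) := by
      rw [Finset.sum_range_succ']
      simp only [Nat.cast_zero, mul_zero, zero_mul, add_zero]
      refine Finset.sum_congr rfl fun m _ => ?_
      have := Nat.add_one_mul_choose_eq n m
      have : ((n + 1 : ℕ) : ℝ) * n.choose m = (n + 1).choose (m + 1) * (m + 1 : ℕ) := by
        exact_mod_cast this
      rw [← this]; push_cast; ring
    have e₂ : ∑ m ∈ Finset.range (n + 1 + 1), ((n + 1).choose m : ℝ) * ((n + 1 : ℕ) - m) * φ m =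
        ∑ m ∈ Finset.range (n + 1), (n + 1 : ℝ) * n.choose m * φ m := by
      rw [Finset.sum_range_succ]
      simp only [sub_self, mul_zero, zero_mul, add_zero]
      refine Finset.sum_congr rfl fun m hm => ?_
      have hm' : m ≤ n := by simpa [Nat.lt_succ_iff] using hm
      have := Nat.choose_mul_succ_eq n m
      have : (n.choose m : ℝ) * (n + 1 : ℕ) = (n + 1).choose m * ((n + 1 - m : ℕ) : ℝ) := by
        exact_mod_cast this
      rw [Nat.cast_sub (by omega)] at this
      rw [← this]; push_cast; ring
    have : ∀ m : ℕ, ((n + 1).choose m : ℝ) * (2 * m - (n + 1 : ℕ)) * φ m =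
      ((n + 1).choose m : ℝ) * m * φ m - ((n + 1).choose m : ℝ) * ((n + 1 : ℕ) - m) * φ m := by
      intro m; ring
    simp only [this]
    rw [Finset.sum_sub_distrib, e₁, e₂, ← Finset.sum_sub_distrib, Finset.mul_sum]
    exact Finset.sum_congr rfl fun m _ => by ring
  -- AM-GM, |t| ≤ (t²/s + s)/2, with s = √(n+1) the standard deviation of t = 2m - (n+1). This
  -- bounds the first absolute moment by the second.
  have bound : |∑ m ∈ Finset.range (n + 1 + 1),
      ((n + 1).choose m : ℝ) * (2 * m - (n + 1 : ℕ)) * φ m| ≤ 2 ^ (n + 1) * s := by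
    calc _ ≤ ∑ m ∈ Finset.range (n + 1 + 1),
          ((n + 1).choose m : ℝ) * (((2 * m - (n + 1 : ℕ)) ^ 2 / s + s) / 2) := by
          refine (Finset.abs_sum_le_sum_abs _ _).trans (Finset.sum_le_sum fun m _ => ?_)
          rw [abs_mul, abs_mul, Nat.abs_cast, mul_assoc]
          refine mul_le_mul_of_nonneg_left ?_ (Nat.cast_nonneg _)
          set t : ℝ := 2 * m - (n + 1 : ℕ)
          calc |t| * |φ m| ≤ |t| * 1 := mul_le_mul_of_nonneg_left (hφ m) (abs_nonneg _)
            _ ≤ (t ^ 2 / s + s) / 2 := by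
              have : (t ^ 2 / s + s) / 2 - |t| = (|t| - s) ^ 2 / (2 * s) := by
                rw [← sq_abs t]; field_simp; ring
              have h2 : 0 ≤ (|t| - s) ^ 2 / (2 * s) := by positivity
              linarith
      _ = (∑ m ∈ Finset.range (n + 1 + 1), ((n + 1).choose m : ℝ) * (2 * m - (n + 1 : ℕ)) ^ 2)
            / (2 * s) + (∑ m ∈ Finset.range (n + 1 + 1), ((n + 1).choose m : ℝ)) * (s / 2) := by
          rw [Finset.sum_div, Finset.sum_mul, ← Finset.sum_add_distrib]
          refine Finset.sum_congr rfl fun m _ => ?_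
          field_simp
      _ = 2 ^ (n + 1) * s := by
          rw [sum_choose_mul_sub_sq]
          have : ∑ m ∈ Finset.range (n + 1 + 1), ((n + 1).choose m : ℝ) = 2 ^ (n + 1) := by
            exact_mod_cast Nat.sum_range_choose (n + 1)
          rw [this]
          push_cast
          rw [← hss]
          field_simp
          ring
  rw [← key, abs_mul, abs_of_pos (by positivity), ← hss] at bound
  have : s * |∑ m ∈ Finset.range (n + 1), (n.choose m : ℝ) * (φ (m + 1) - φ m)| ≤
      2 ^ (n + 1) := by
    refine le_of_mul_le_mul_left ?_ hspos
    linarith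
  rw [div_mul_eq_mul_div, le_div_iff₀ hspos, mul_comm, ← pow_succ']
  exact this

theorem abs_sum_powerset_shift_sub_le {α : Type*} (V : Finset α) (φ : ℕ → ℝ)
    (hφ : ∀ m, |φ m| ≤ 1) (j : ℕ) :
    |∑ x ∈ V.powerset, (φ (x.card + j) - φ x.card)| ≤ j * (2 / √(V.card + 1) * 2 ^ V.card) := by
  induction j with
  | zero => simp
  | succ j ih =>
    have h := abs_sum_choose_mul_shift_sub_le V.card (fun m => φ (m + j)) (fun m => hφ _)
    have e : ∑ x ∈ V.powerset, (φ (x.card + (j + 1)) - φ (x.card + j)) =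
        ∑ m ∈ Finset.range (V.card + 1), (V.card.choose m : ℝ) * (φ (m + 1 + j) - φ (m + j)) := by
      rw [Finset.sum_powerset_apply_card (fun m => φ (m + (j + 1)) - φ (m + j))]
      simp only [nsmul_eq_mul]
      refine Finset.sum_congr rfl fun m _ => ?_
      rw [show m + 1 + j = m + (j + 1) by ring]
    rw [← e] at h
    have : ∑ x ∈ V.powerset, (φ (x.card + (j + 1)) - φ x.card) =
        ∑ x ∈ V.powerset, (φ (x.card + (j + 1)) - φ (x.card + j)) +
          ∑ x ∈ V.powerset, (φ (x.card + j) - φ x.card) := by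
      rw [← Finset.sum_add_distrib]
      exact Finset.sum_congr rfl fun x _ => by ring
    rw [this]
    refine (abs_add_le _ _).trans ?_
    push_cast
    linarith

theorem tendsto_two_div_sqrt : Tendsto (fun n : ℕ => 2 / √((n : ℝ) + 1)) atTop (𝓝 0) := by
  refine tendsto_const_nhds.div_atTop (Real.tendsto_sqrt_atTop.comp ?_)
  exact tendsto_atTop_add_const_right _ _ tendsto_natCast_atTop_atTop

/-! ### Bias of polynomials whose high-degree parts are symmetric -/

/-- The character `a ↦ (-1) ^ a` of `𝔽₂`. -/
def signChar (a : ZMod 2) : ℝ := if a = 0 then 1 else -1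

theorem signChar_add_one (a : ZMod 2) : signChar (a + 1) = -signChar a := by
  have h : ∀ a : ZMod 2, a = 0 ∨ a = 1 := by decide
  rcases h a with rfl | rfl
  · simp [signChar]
  · simp [signChar, show (1 + 1 : ZMod 2) = 0 by decide]

theorem abs_signChar (a : ZMod 2) : |signChar a| = 1 := by
  unfold signChar; split_ifs <;> simp

/-- Compare coefficients in (1+X)^(w+2^ℓ) = (1+X)^w (1 + X^(2^ℓ)), which is Frobenius in
characteristic 2. -/
theorem cast_choose_add_two_pow (ℓ w j : ℕ) :
    ((w + 2 ^ ℓ).choose j : ZMod 2) =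
      w.choose j + if 2 ^ ℓ ≤ j then (w.choose (j - 2 ^ ℓ) : ZMod 2) else 0 := by
  have h : (1 + Polynomial.X : Polynomial (ZMod 2)) ^ (w + 2 ^ ℓ) =
      (1 + Polynomial.X) ^ w + (1 + Polynomial.X) ^ w * Polynomial.X ^ 2 ^ ℓ := by
    rw [pow_add, add_pow_char_pow, one_pow, mul_add, mul_one]
  have h' := congrArg (fun q => Polynomial.coeff q j) h
  simpa only [Polynomial.coeff_add, Polynomial.coeff_one_add_X_pow,
    Polynomial.coeff_mul_X_pow'] using h'

theorem sum_powerset_union {α β : Type*} [DecidableEq α] [AddCommMonoid β] {s t : Finset α}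
    (h : Disjoint s t) (f : Finset α → β) :
    ∑ x ∈ (s ∪ t).powerset, f x = ∑ x ∈ s.powerset, ∑ y ∈ t.powerset, f (x ∪ y) := by
  rw [← Finset.sum_product']
  symm
  refine Finset.sum_bij' (fun q _ => q.1 ∪ q.2) (fun x _ => (x ∩ s, x ∩ t)) ?_ ?_ ?_ ?_ ?_
  · intro q hq
    simp only [Finset.mem_product, Finset.mem_powerset] at hq ⊢
    exact Finset.union_subset_union hq.1 hq.2
  · intro x _
    simp
  · rintro ⟨a, b⟩ hq
    simp only [Finset.mem_product, Finset.mem_powerset] at hq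
    have h₁ : Disjoint b s := (h.mono_right hq.2).symm
    have h₂ : Disjoint a t := h.mono_left hq.1
    simp only [Finset.union_inter_distrib_right, Finset.inter_eq_left.mpr hq.1,
      Finset.inter_eq_left.mpr hq.2, Finset.disjoint_iff_inter_eq_empty.mp h₁,
      Finset.disjoint_iff_inter_eq_empty.mp h₂, Finset.union_empty, Finset.empty_union]
  · intro x hx
    simp only [Finset.mem_powerset] at hx
    rw [← Finset.inter_union_distrib_left, Finset.inter_eq_left.mpr hx]
  · intro q _
    rfl

/-- A symmetric polynomial over `𝔽₂` of degree `2 ^ ℓ` changes value under a shift of the weight by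
`2 ^ ℓ`. -/
theorem sum_choose_mul_add_two_pow (ℓ : ℕ) (s : ℕ → ZMod 2) (hs : s (2 ^ ℓ) = 1) (w : ℕ) :
    ∑ j ∈ Finset.range (2 ^ ℓ + 1), ((w + 2 ^ ℓ).choose j : ZMod 2) * s j =
      (∑ j ∈ Finset.range (2 ^ ℓ + 1), (w.choose j : ZMod 2) * s j) + 1 := by
  simp only [cast_choose_add_two_pow, add_mul, Finset.sum_add_distrib]
  congr 1
  rw [Finset.sum_range_succ, Finset.sum_eq_zero]
  · simp [hs]
  · intro j hj
    rw [if_neg (by simpa using hj), zero_mul]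

theorem sum_powerset_eq_of_symmetric {α : Type*} (b : ℕ) (s : ℕ → ZMod 2)
    (hs : ∀ j, b < j → s j = 0) (x : Finset α) :
    ∑ M ∈ x.powerset, s M.card =
      ∑ j ∈ Finset.range (b + 1), (x.card.choose j : ZMod 2) * s j := by
  rw [Finset.sum_powerset_apply_card]
  simp only [nsmul_eq_mul]
  have h₁ := Finset.sum_subset (Finset.range_mono (le_max_left (x.card + 1) (b + 1)))
    (f := fun j => (x.card.choose j : ZMod 2) * s j) (fun j _ hj => by
      rw [Nat.choose_eq_zero_of_lt (by simpa using hj)]; simp)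
  have h₂ := Finset.sum_subset (Finset.range_mono (le_max_right (x.card + 1) (b + 1)))
    (f := fun j => (x.card.choose j : ZMod 2) * s j) (fun j _ hj => by
      rw [hs j (by simpa using hj)]; simp)
  rw [h₁, h₂]

/-- A polynomial over `𝔽₂` of degree `2 ^ ℓ` whose homogeneous parts of degree greater than `k`
are symmetric, where `k < 2 ^ ℓ`, has small bias in sufficiently many variables. Points are given
by their supports, and `p M` is the coefficient of the monomial `∏ i ∈ M, X i`. -/
theorem exists_bias_le (ℓ k : ℕ) (hk : k < 2 ^ ℓ) :
    ∀ ε : ℝ, 0 < ε → ∃ N : ℕ, ∀ {α : Type u} [DecidableEq α] (V : Finset α), N ≤ V.card →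
      ∀ (p : Finset α → ZMod 2) (s : ℕ → ZMod 2), s (2 ^ ℓ) = 1 → (∀ j, 2 ^ ℓ < j → s j = 0) →
        (∀ M ⊆ V, k < M.card → p M = s M.card) →
        |∑ x ∈ V.powerset, signChar (∑ M ∈ x.powerset, p M)| ≤ ε * 2 ^ V.card := by
  induction k with
  | zero =>
    intro ε hε
    have hlim := tendsto_two_div_sqrt.const_mul ((2 : ℝ) ^ ℓ)
    rw [mul_zero] at hlim
    obtain ⟨N, hN⟩ := eventually_atTop.mp (hlim.eventually (ge_mem_nhds hε))
    refine ⟨N, fun {α} _ V hV p s hs hs' hp => ?_⟩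
    -- The hypothesis says nothing about the constant coefficient, so `s'` takes it from p; the
    -- value at 2^ℓ is unaffected.
    set s' : ℕ → ZMod 2 := fun j => if j = 0 then p ∅ else s j with hs'def
    set h : ℕ → ZMod 2 := fun w => ∑ j ∈ Finset.range (2 ^ ℓ + 1), (w.choose j : ZMod 2) * s' j
      with hh
    have hF : ∀ x ∈ V.powerset, signChar (∑ M ∈ x.powerset, p M) = signChar (h x.card) := by
      intro x hx
      congr 1
      simp only [hh]
      rw [← sum_powerset_eq_of_symmetric (2 ^ ℓ) s'
        (fun j hj => by rw [hs'def]; simp only; rw [if_neg (by omega), hs' j hj])]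
      refine Finset.sum_congr rfl fun M hM => ?_
      rcases Finset.eq_empty_or_nonempty M with rfl | hne
      · simp [hs'def]
      · rw [hs'def]
        simp only
        rw [if_neg (Finset.card_ne_zero.mpr hne)]
        exact hp M ((Finset.mem_powerset.mp hM).trans (Finset.mem_powerset.mp hx))
          (Finset.card_pos.mpr hne)
    rw [Finset.sum_congr rfl hF]
    have hshift := abs_sum_powerset_shift_sub_le V (fun w => signChar (h w))
      (fun m => (abs_signChar _).le) (2 ^ ℓ)
    have hneg : ∀ w, signChar (h (w + 2 ^ ℓ)) = -signChar (h w) := by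
      intro w
      rw [hh]
      simp only
      rw [sum_choose_mul_add_two_pow ℓ s' (by simp [hs'def, hs]), signChar_add_one]
    simp only [hneg] at hshift
    have e : ∑ x ∈ V.powerset, (-signChar (h x.card) - signChar (h x.card)) =
        -(2 * ∑ x ∈ V.powerset, signChar (h x.card)) := by
      rw [Finset.mul_sum, ← Finset.sum_neg_distrib]
      exact Finset.sum_congr rfl fun x _ => by ring
    rw [e, abs_neg, abs_mul, abs_two] at hshift
    have hN' := mul_le_mul_of_nonneg_right (hN V.card hV) (show (0 : ℝ) ≤ 2 ^ V.card by positivity)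
    push_cast at hshift
    have := abs_nonneg (∑ x ∈ V.powerset, signChar (h x.card))
    linarith
  | succ k ih =>
    intro ε hε
    obtain ⟨N, hN⟩ := ih (by omega) ε hε
    obtain ⟨R, hR⟩ := exists_ramsey_uniform (k + 1) N N
    -- The two colours of a (k+1)-set are the two possible values of its coefficient. Only the fixed
    -- number N of variables in T stays free; the bias bound is applied on each fibre.
    refine ⟨R, fun {α} _ V hV p s hs hs' hp => ?_⟩
    obtain ⟨T, hTV, hTc, c, hc⟩ : ∃ T ⊆ V, T.card = N ∧ ∃ c : ZMod 2,
        ∀ K ⊆ T, K.card = k + 1 → p K = c := by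
      have h2 : ∀ a : ZMod 2, a ≠ 0 → a = 1 := by decide
      rcases hR V hV (fun K => p K = 0) with ⟨T, hT, hTc, h⟩ | ⟨T, hT, hTc, h⟩
      · exact ⟨T, hT, hTc, 0, h⟩
      · exact ⟨T, hT, hTc, 1, fun K hK hKc => h2 _ (h K hK hKc)⟩
    have hdisj : Disjoint (V \ T) T := Finset.sdiff_disjoint
    have hVeq : V \ T ∪ T = V := Finset.sdiff_union_of_subset hTV
    have hcard : V.card = (V \ T).card + T.card := by
      rw [← Finset.card_union_of_disjoint hdisj, hVeq]
    have hfix : ∀ y ∈ (V \ T).powerset,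
        |∑ x ∈ T.powerset, signChar (∑ M ∈ (y ∪ x).powerset, p M)| ≤ ε * 2 ^ T.card := by
      intro y hy
      rw [Finset.mem_powerset] at hy
      have e : ∀ x ∈ T.powerset, signChar (∑ M ∈ (y ∪ x).powerset, p M) =
          signChar (∑ M ∈ x.powerset, ∑ L ∈ y.powerset, p (L ∪ M)) := by
        intro x hx
        rw [Finset.mem_powerset] at hx
        rw [sum_powerset_union ((hdisj.mono_left hy).mono_right hx), Finset.sum_comm]
      rw [Finset.sum_congr rfl e]
      -- With the outside variables fixed to have support y, the coefficient of M becomes the sum of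
      -- p (L ∪ M) over L ⊆ y. When |M| > k, size k + 1 forces L = ∅, and there the common value is
      -- c. At degree 2^ℓ only L = ∅ contributes, so the top coefficient stays 1.
      set s₁ : ℕ → ZMod 2 := fun j => if j = k + 1 then c else s j with hs₁
      refine hN T hTc.ge (fun M => ∑ L ∈ y.powerset, p (L ∪ M))
        (fun j => ∑ L ∈ y.powerset, s₁ (L.card + j)) ?_ ?_ ?_
      · rw [Finset.sum_eq_single ∅]
        · simp only [hs₁, Finset.card_empty, zero_add]
          rw [if_neg (by omega), hs]
        · intro L _ hL
          have := Finset.card_pos.mpr (Finset.nonempty_iff_ne_empty.mpr hL)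
          simp only [hs₁]
          rw [if_neg (by omega), hs' _ (by omega)]
        · simp
      · intro j hj
        refine Finset.sum_eq_zero fun L _ => ?_
        simp only [hs₁]
        rw [if_neg (by omega), hs' _ (by omega)]
      · intro M hM hMk
        refine Finset.sum_congr rfl fun L hL => ?_
        rw [Finset.mem_powerset] at hL
        have hLM : (L ∪ M).card = L.card + M.card :=
          Finset.card_union_of_disjoint ((hdisj.mono_left (hL.trans hy)).mono_right hM)
        simp only [hs₁]
        split_ifs with hcase
        · have hL0 : L = ∅ := Finset.card_eq_zero.mp (by omega)
          subst hL0
          rw [Finset.empty_union]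
          exact hc M hM (by simpa using hcase)
        · rw [← hLM]
          refine hp _ (Finset.union_subset ((hL.trans hy).trans Finset.sdiff_subset)
            (hM.trans hTV)) (by omega)
    have hsum := sum_powerset_union hdisj (fun x => signChar (∑ M ∈ x.powerset, p M))
    rw [hVeq] at hsum
    rw [hsum]
    refine (Finset.abs_sum_le_sum_abs _ _).trans ((Finset.sum_le_sum hfix).trans_eq ?_)
    rw [Finset.sum_const, Finset.card_powerset, hcard, pow_add, nsmul_eq_mul]
    push_cast
    ring

/-! ### Passage from the torus to 𝔽₂ and to supports; the classical bound -/

theorem toTorus_zero : toTorus 0 = 0 := by simp [toTorus]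

theorem toTorus_natCast (m : ℕ) : toTorus (m : ZMod 2) = ((m / 2 : ℝ) : UnitAddCircle) := by
  have h : ((m : ℝ) / 2) = ((m % 2 : ℕ) : ℝ) / 2 + ((m / 2 : ℕ) : ℝ) := by
    have : (m : ℝ) = ((m % 2 : ℕ) : ℝ) + 2 * ((m / 2 : ℕ) : ℝ) := by
      exact_mod_cast (Nat.mod_add_div m 2).symm
    linarith
  have h1 : (((m / 2 : ℕ) : ℝ) : UnitAddCircle) = 0 :=
    (AddCircle.coe_eq_zero_iff 1).mpr ⟨((m / 2 : ℕ) : ℤ), by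
      rw [zsmul_eq_mul, mul_one, Int.cast_natCast]⟩
  rw [toTorus, ZMod.val_natCast, h, AddCircle.coe_add, h1, add_zero]

theorem toTorus_add (a b : ZMod 2) : toTorus (a + b) = toTorus a + toTorus b := by
  obtain ⟨m, rfl⟩ := ZMod.natCast_zmod_surjective a
  obtain ⟨k, rfl⟩ := ZMod.natCast_zmod_surjective b
  rw [← Nat.cast_add, toTorus_natCast, toTorus_natCast, toTorus_natCast, ← AddCircle.coe_add]
  congr 1
  push_cast
  ring

theorem toTorus_one_ne_zero : toTorus 1 ≠ 0 := by
  intro h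
  have h1 : (((1 : ℝ) / 2 : ℝ) : UnitAddCircle) = 0 := by
    rw [← h]; simpa using (toTorus_natCast 1).symm
  obtain ⟨k, hk⟩ := (AddCircle.coe_eq_zero_iff (1 : ℝ)).mp h1
  have : (2 * k : ℝ) = 1 := by
    simp only [zsmul_eq_mul, mul_one] at hk
    rw [hk]; norm_num
  have : (2 * k : ℤ) = 1 := by exact_mod_cast this
  omega

theorem toTorus_eq_iff (a b : ZMod 2) : toTorus a = toTorus b ↔ a + b = 0 := by
  have h : ∀ a : ZMod 2, a = 0 ∨ a = 1 := by decide
  have h1 := toTorus_one_ne_zero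
  rcases h a with rfl | rfl <;> rcases h b with rfl | rfl
  · simp
  · simpa [toTorus_zero] using h1.symm
  · simpa [toTorus_zero] using h1
  · simpa using (by decide : (1 + 1 : ZMod 2) = 0)

theorem toTorus_sum {ι : Type*} (s : Finset ι) (f : ι → ZMod 2) :
    toTorus (∑ i ∈ s, f i) = ∑ i ∈ s, toTorus (f i) :=
  map_sum (⟨⟨toTorus, toTorus_zero⟩, toTorus_add⟩ : ZMod 2 →+ UnitAddCircle) f s

/-- The point of `𝔽₂ⁿ` with a given support. -/
def indicatorPoint {n : ℕ} (X : Finset (Fin n)) (i : Fin n) : ZMod 2 := if i ∈ X then 1 else 0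

theorem indicatorPoint_bijective (n : ℕ) :
    Function.Bijective (indicatorPoint : Finset (Fin n) → Fin n → ZMod 2) := by
  constructor
  · intro X Y h
    ext i
    have := congrFun h i
    by_cases hX : i ∈ X <;> by_cases hY : i ∈ Y <;> simp_all [indicatorPoint]
  · intro x
    refine ⟨Finset.univ.filter fun i => x i = 1, funext fun i => ?_⟩
    have h : ∀ a : ZMod 2, (if a = 1 then 1 else 0) = a := by decide
    simpa [indicatorPoint] using h (x i)

theorem agr_eq_sum_powerset {n : ℕ} {R : Type*} [DecidableEq R] (F G : (Fin n → ZMod 2) → R) :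
    agr F G = (∑ X ∈ (Finset.univ : Finset (Fin n)).powerset,
      if F (indicatorPoint X) = G (indicatorPoint X) then (1 : ℝ) else 0) / 2 ^ n := by
  unfold agr
  rw [Fintype.card_fun, ZMod.card, Fintype.card_fin]
  push_cast
  congr 1
  rw [Finset.powerset_univ, Function.Bijective.sum_comp (indicatorPoint_bijective n)
    (fun x => if F x = G x then (1 : ℝ) else 0), Finset.sum_boole]
  congr

theorem prod_val_indicatorPoint {n : ℕ} (X S : Finset (Fin n)) :
    ∏ i ∈ S, ((indicatorPoint X i).val : ℝ) = if S ⊆ X then 1 else 0 := by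
  have h : ∀ i, ((indicatorPoint X i).val : ℝ) = if i ∈ X then 1 else 0 := by
    intro i
    by_cases hi : i ∈ X <;> simp [indicatorPoint, hi, ZMod.val_one]
  simp only [h]
  rw [Finset.prod_boole]
  rfl

theorem elemSym_indicatorPoint {n : ℕ} (t : ℕ) (X : Finset (Fin n)) :
    elemSym n t (indicatorPoint X) = toTorus (X.card.choose t : ZMod 2) := by
  unfold elemSym
  congr 1
  simp only [MvPolynomial.esymm, map_sum, map_prod, MvPolynomial.eval_X, indicatorPoint]
  have hprod : ∀ S : Finset (Fin n), (∏ i ∈ S, if i ∈ X then (1 : ZMod 2) else 0) =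
      if S ⊆ X then 1 else 0 := fun S => Finset.prod_boole
  simp only [hprod]
  rw [← Finset.sum_filter, Finset.sum_const, nsmul_eq_mul, mul_one, ← Finset.card_powersetCard]
  refine congrArg (fun s : Finset (Finset (Fin n)) => (s.card : ZMod 2)) ?_
  ext S
  simp only [Finset.mem_filter, Finset.mem_powersetCard, Finset.subset_univ, true_and]
  exact and_comm

namespace NonclassicalPolynomial

/-- Depth at most 1 leaves only denominators 2, so the sum takes place inside the copy of 𝔽₂; the
shift becomes the coefficient a of the empty monomial. -/
theorem IsClassical.eval_indicatorPoint {n : ℕ} {P : NonclassicalPolynomial n}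
    (hP : P.IsClassical) : ∃ a : ZMod 2, ∀ X : Finset (Fin n),
      P.eval (indicatorPoint X) = toTorus (∑ M ∈ X.powerset,
        ((if M = ∅ then a else 0) + if (M, 1) ∈ P.terms then 1 else 0)) := by
  obtain ⟨a, ha⟩ : ∃ a, P.shift = toTorus a := by
    rcases hP.1 with h | h
    exacts [⟨0, h⟩, ⟨1, h⟩]
  have hone : ∀ t ∈ P.terms, t.2 = 1 := fun t ht =>
    le_antisymm ((Finset.le_sup (f := fun t : Finset (Fin n) × ℕ => t.2) ht).trans hP.2)
      (P.one_le_of_mem t ht)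
  refine ⟨a, fun X => ?_⟩
  have hterm : ∀ t ∈ P.terms,
      (((∏ i ∈ t.1, ((indicatorPoint X i).val : ℝ)) / 2 ^ t.2 : ℝ) : UnitAddCircle) =
        toTorus (if t.1 ⊆ X then 1 else 0) := by
    intro t ht
    rw [prod_val_indicatorPoint, hone t ht]
    split_ifs
    · simpa using (toTorus_natCast 1).symm
    · simp [toTorus_zero]
  rw [NonclassicalPolynomial.eval, Finset.sum_congr rfl hterm, ← toTorus_sum, ha, ← toTorus_add]
  congr 1
  rw [Finset.sum_add_distrib]
  congr 1
  · simp
  · rw [← Finset.sum_filter, ← Finset.sum_filter]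
    refine Finset.sum_bij' (fun t _ => t.1) (fun M _ => (M, 1)) ?_ ?_ ?_ ?_ ?_
    · rintro ⟨M, j⟩ ht
      rw [Finset.mem_filter] at ht
      have : j = 1 := hone _ ht.1
      subst this
      simpa using ⟨ht.2, ht.1⟩
    · intro M hM
      simpa [and_comm] using hM
    · rintro ⟨M, j⟩ ht
      rw [Finset.mem_filter] at ht
      rw [Prod.mk.injEq]
      exact ⟨rfl, (hone _ ht.1).symm⟩
    · intro M _
      rfl
    · intro t _
      rfl

end NonclassicalPolynomial

theorem agr_le_one {D R : Type*} [Fintype D] (F G : D → R) : agr F G ≤ 1 := by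
  unfold agr
  exact div_le_one_of_le₀ (by exact_mod_cast Finset.card_le_univ _) (Nat.cast_nonneg _)

/-- Classical polynomials of degree less than `2 ^ ℓ` asymptotically agree with `S_{2 ^ ℓ}` on at
most half of the points. -/
theorem exists_agr_elemSym_classical_le (ℓ d : ℕ) (hd : d < 2 ^ ℓ) (ε : ℝ) (hε : 0 < ε) :
    ∃ N : ℕ, ∀ n, N ≤ n → ∀ P : NonclassicalPolynomial n, P.IsClassical → P.degree ≤ d →
      agr (elemSym n (2 ^ ℓ)) P.eval ≤ 1 / 2 + ε := by
  classical
  obtain ⟨N, hN⟩ := exists_bias_le ℓ d hd ε hε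
  refine ⟨N, fun n hn P hP hPd => ?_⟩
  obtain ⟨a, ha⟩ := hP.eval_indicatorPoint
  set q : Finset (Fin n) → ZMod 2 := fun M =>
    (if M = ∅ then a else 0) + if (M, 1) ∈ P.terms then 1 else 0 with hq
  set s : ℕ → ZMod 2 := fun j => if j = 2 ^ ℓ then 1 else 0 with hs
  have hqd : ∀ M, d < M.card → q M = 0 := by
    intro M hM
    have h₁ : M ≠ ∅ := by rintro rfl; simp at hM
    have h₂ : (M, 1) ∉ P.terms := fun h => by
      have : M.card + (1 - 1) ≤ P.degree :=
        Finset.le_sup (f := fun t : Finset (Fin n) × ℕ => t.1.card + (t.2 - 1)) h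
      omega
    simp [hq, h₁, h₂]
  have hbias := hN (Finset.univ : Finset (Fin n)) (by simpa using hn)
    (fun M => s M.card + q M) s (by simp [hs])
    (fun j hj => by simp only [hs]; rw [if_neg (by omega)])
    (fun M _ hM => by rw [hqd M hM, add_zero])
  rw [Finset.card_fin] at hbias
  -- The indicator of agreement is (1 + (-1)^(F+G))/2, so agreement exceeds 1/2 by half the bias of
  -- the sum.
  have hind : ∀ X ∈ (Finset.univ : Finset (Fin n)).powerset,
      (if elemSym n (2 ^ ℓ) (indicatorPoint X) = P.eval (indicatorPoint X) then (1 : ℝ) else 0) =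
        1 / 2 + 1 / 2 * signChar (∑ M ∈ X.powerset, (s M.card + q M)) := by
    intro X _
    have hS : (X.card.choose (2 ^ ℓ) : ZMod 2) = ∑ M ∈ X.powerset, s M.card := by
      rw [sum_powerset_eq_of_symmetric (2 ^ ℓ) s
        (fun j hj => by simp only [hs]; rw [if_neg (by omega)])]
      simp [hs]
    have hiff : elemSym n (2 ^ ℓ) (indicatorPoint X) = P.eval (indicatorPoint X) ↔
        ∑ M ∈ X.powerset, (s M.card + q M) = 0 := by
      rw [elemSym_indicatorPoint, ha, toTorus_eq_iff, hS, ← Finset.sum_add_distrib]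
    unfold signChar
    simp only [hiff]
    split_ifs <;> norm_num
  rw [agr_eq_sum_powerset, Finset.sum_congr rfl hind, Finset.sum_add_distrib, ← Finset.mul_sum,
    div_le_iff₀ (by positivity)]
  have := (le_abs_self _).trans hbias
  simp only [Finset.sum_const, Finset.card_powerset, Finset.card_fin, nsmul_eq_mul]
  push_cast
  have h2 : (0 : ℝ) < ε * 2 ^ n := by positivity
  linarith

theorem exists_tendsto_zero_classical (ℓ d : ℕ) (hd : d < 2 ^ ℓ) :
    ∃ ε : ℕ → ℝ, Tendsto ε atTop (𝓝 0) ∧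
      ∀ n : ℕ, 1 ≤ n → ∀ P : NonclassicalPolynomial n, P.IsClassical → P.degree ≤ d →
        agr (elemSym n (2 ^ ℓ)) P.eval ≤ 1 / 2 + ε n := by
  -- The supremum of all excesses gives one error function uniform in P; including 0 makes it
  -- nonnegative.
  set A : ℕ → Set ℝ := fun n => insert 0 {r | ∃ P : NonclassicalPolynomial n,
    P.IsClassical ∧ P.degree ≤ d ∧ r = agr (elemSym n (2 ^ ℓ)) P.eval - 1 / 2} with hA
  have hbdd : ∀ n, BddAbove (A n) := fun n => ⟨1, by
    rintro r (rfl | ⟨P, -, -, rfl⟩)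
    · exact zero_le_one
    · linarith [agr_le_one (elemSym n (2 ^ ℓ)) P.eval]⟩
  refine ⟨fun n => sSup (A n), ?_, fun n _ P hP hPd => ?_⟩
  · rw [Metric.tendsto_atTop]
    intro δ hδ
    obtain ⟨N, hN⟩ := exists_agr_elemSym_classical_le ℓ d hd (δ / 2) (half_pos hδ)
    refine ⟨N, fun n hn => ?_⟩
    have h₀ : 0 ≤ sSup (A n) := le_csSup (hbdd n) (Set.mem_insert _ _)
    have h₁ : sSup (A n) ≤ δ / 2 := csSup_le ⟨0, Set.mem_insert _ _⟩ (by
      rintro r (rfl | ⟨P, hP, hPd, rfl⟩)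
      · exact (half_pos hδ).le
      · linarith [hN n hn P hP hPd])
    rw [Real.dist_eq, sub_zero, abs_of_nonneg h₀]
    linarith
  · have := le_csSup (hbdd n) (Set.mem_insert_of_mem _ ⟨P, hP, hPd, rfl⟩)
    linarith

/-! ### Binomial coefficients modulo 8 -/

/-- Modulo 8, (1+X)^8 = (1+X²)^4; raise to the power q and compare coefficients of X^(2K). -/
theorem choose_eight_mul_two_mul_modEq (q K : ℕ) :
    (8 * q).choose (2 * K) ≡ (4 * q).choose K [MOD 8] := by
  rw [← ZMod.natCast_eq_natCast_iff]
  have h8 : (8 : Polynomial (ZMod 8)) = 0 := by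
    have : ((8 : ℕ) : Polynomial (ZMod 8)) = 0 := CharP.cast_eq_zero _ 8
    exact_mod_cast this
  have h : (1 + Polynomial.X : Polynomial (ZMod 8)) ^ (8 * q) =
      Polynomial.expand (ZMod 8) 2 ((1 + Polynomial.X) ^ (4 * q)) := by
    rw [pow_mul, pow_mul, map_pow]
    congr 1
    simp only [map_pow, map_add, map_one, Polynomial.expand_X]
    linear_combination (Polynomial.X + 3 * Polynomial.X ^ 2 + 7 * Polynomial.X ^ 3 +
      8 * Polynomial.X ^ 4 + 7 * Polynomial.X ^ 5 + 3 * Polynomial.X ^ 6 + Polynomial.X ^ 7) * h8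
  have h' := congrArg (fun r => Polynomial.coeff r (2 * K)) h
  simp only [Polynomial.coeff_one_add_X_pow] at h'
  rw [h', mul_comm 2 K, Polynomial.coeff_expand_mul (by norm_num), Polynomial.coeff_one_add_X_pow]

/-- From gj·C(n, gj) = n·C(n-1, gj-1), cancel g: a divides j·C(n, gj), and a is coprime to j. For j
= 0 coprimality forces a = 1. -/
theorem dvd_choose_of_coprime {a g n j : ℕ} (ha : Nat.Coprime a j) (hn : a * g ∣ n) (hg : 0 < g) :
    a ∣ n.choose (g * j) := by
  rcases Nat.eq_zero_or_pos (g * j) with h | h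
  · have : j = 0 := by
      rcases Nat.mul_eq_zero.mp h with h | h
      · omega
      · exact h
    subst this
    simpa using ha
  · rcases n with _ | n
    · simp [Nat.choose_eq_zero_of_lt h]
    · obtain ⟨i, hi⟩ := Nat.exists_eq_add_of_lt h
      rw [zero_add] at hi
      obtain ⟨c, hc⟩ := hn
      have key := Nat.add_one_mul_choose_eq n i
      rw [← hi, hc] at key
      have : a * (c * n.choose i) = (a * g * c).choose (g * j) * j := by
        refine Nat.eq_of_mul_eq_mul_left hg ?_
        linarith
      rw [hc]
      exact ha.dvd_of_dvd_mul_right ⟨_, this.symm⟩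

theorem choose_add_eq_sum (n : ℕ) {r j : ℕ} (h : r ≤ j) :
    (n + r).choose j = ∑ i ∈ Finset.range (r + 1), r.choose i * n.choose (j - i) := by
  rw [add_comm, Nat.add_choose_eq, Finset.Nat.sum_antidiagonal_eq_sum_range_succ
    (fun a b => r.choose a * n.choose b)]
  symm
  refine Finset.sum_subset (Finset.range_mono (by omega)) fun i _ hi => ?_
  rw [Nat.choose_eq_zero_of_lt (by simpa using hi), zero_mul]

/-- Halving both entries of a binomial coefficient does not change it modulo `8` if the lower one
is divisible by `8`. -/
theorem choose_two_mul_modEq_choose_half (w : ℕ) {K : ℕ} (hK : 4 ∣ K) :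
    w.choose (2 * K) ≡ (w / 2).choose K [MOD 8] := by
  rcases Nat.eq_zero_or_pos K with rfl | hpos
  · simp [Nat.ModEq]
  -- With 2K = 8k + 8 and w = 8q + r, r < 8, the Vandermonde expansion has no truncated index.
  obtain ⟨k, rfl⟩ : ∃ k, K = 4 * k + 4 := ⟨K / 4 - 1, by omega⟩
  obtain ⟨q, r, hr, rfl⟩ : ∃ q r, r < 8 ∧ w = 8 * q + r :=
    ⟨w / 8, w % 8, Nat.mod_lt _ (by norm_num), (Nat.div_add_mod w 8).symm⟩
  have odd8 : ∀ j, 8 ∣ (8 * q).choose (2 * j + 1) := fun j => by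
    have : Nat.Coprime 8 (2 * j + 1) := Nat.Coprime.pow_left 3 (by simp : Nat.Coprime 2 (2 * j + 1))
    simpa using dvd_choose_of_coprime (g := 1) this (n := 8 * q) (by simp) (by norm_num)
  have odd4 : ∀ j, 4 ∣ (4 * q).choose (2 * j + 1) := fun j => by
    have : Nat.Coprime 4 (2 * j + 1) := Nat.Coprime.pow_left 2 (by simp : Nat.Coprime 2 (2 * j + 1))
    simpa using dvd_choose_of_coprime (g := 1) this (n := 4 * q) (by simp) (by norm_num)
  have c₂ : 2 ∣ (4 * q).choose (4 * k + 2) := by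
    have := dvd_choose_of_coprime (a := 2) (g := 2) (n := 4 * q) (j := 2 * k + 1) (by simp)
      ⟨q, by ring⟩ (by norm_num)
    rwa [show 2 * (2 * k + 1) = 4 * k + 2 by ring] at this
  have c₁ : 4 ∣ (4 * q).choose (4 * k + 1) := by
    have := odd4 (2 * k)
    rwa [show 2 * (2 * k) + 1 = 4 * k + 1 by ring] at this
  have c₃ : 4 ∣ (4 * q).choose (4 * k + 3) := by
    have := odd4 (2 * k + 1)
    rwa [show 2 * (2 * k + 1) + 1 = 4 * k + 3 by ring] at this
  have hodd : ∀ i, 8 ∣ (8 * q).choose (8 * k + (2 * i + 1)) := fun i => by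
    have := odd8 (4 * k + i)
    rwa [show 2 * (4 * k + i) + 1 = 8 * k + (2 * i + 1) by ring] at this
  have heven : ∀ i, (8 * q).choose (8 * k + 2 * i) % 8 = (4 * q).choose (4 * k + i) % 8 :=
    fun i => by
      have := choose_eight_mul_two_mul_modEq q (4 * k + i)
      rwa [show 2 * (4 * k + i) = 8 * k + 2 * i by ring] at this
  have d₁ : 8 ∣ (8 * q).choose (8 * k + 1) := hodd 0
  have d₃ : 8 ∣ (8 * q).choose (8 * k + 3) := hodd 1
  have d₅ : 8 ∣ (8 * q).choose (8 * k + 5) := hodd 2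
  have d₇ : 8 ∣ (8 * q).choose (8 * k + 7) := hodd 3
  have e₂ : (8 * q).choose (8 * k + 2) % 8 = (4 * q).choose (4 * k + 1) % 8 := heven 1
  have e₄ : (8 * q).choose (8 * k + 4) % 8 = (4 * q).choose (4 * k + 2) % 8 := heven 2
  have e₆ : (8 * q).choose (8 * k + 6) % 8 = (4 * q).choose (4 * k + 3) % 8 := heven 3
  have e₈ : (8 * q).choose (8 * k + 8) % 8 = (4 * q).choose (4 * k + 4) % 8 := heven 4
  have hhalf : (8 * q + r) / 2 = 4 * q + r / 2 := by omega
  have htwo : 2 * (4 * k + 4) = 8 * k + 8 := by ring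
  rw [hhalf, htwo, Nat.ModEq]
  clear hodd heven odd4 odd8 hhalf htwo hK hpos
  rw [choose_add_eq_sum (8 * q) (by omega), choose_add_eq_sum (4 * q) (by omega)]
  -- Odd lower indices of C(8q, ·) vanish modulo 8 and even ones halve. The remaining differences
  -- C(r, 2i) - C(⌊r/2⌋, i) are absorbed by the factors 4, 2, 4 of C(4q, 4k+3), C(4q, 4k+2), C(4q,
  -- 4k+1).
  interval_cases r <;> simp [Finset.sum_range_succ, Nat.choose]
  all_goals omega

theorem choose_two_pow_mul_modEq (i w : ℕ) {K : ℕ} (hK : 4 ∣ K) :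
    w.choose (2 ^ i * K) ≡ (w / 2 ^ i).choose K [MOD 8] := by
  induction i generalizing w with
  | zero => simp [Nat.ModEq]
  | succ i ih =>
    rw [pow_succ', mul_assoc, ← Nat.div_div_eq_div_mul]
    exact (choose_two_mul_modEq_choose_half w (hK.mul_left _)).trans (ih _)

/-- In Vandermonde's identity only the term taking nothing from N survives modulo m. -/
theorem choose_add_modEq_of_dvd {m N j : ℕ} (h : ∀ i, 1 ≤ i → i ≤ j → m ∣ N.choose i) (u : ℕ) :
    (u + N).choose j ≡ u.choose j [MOD m] := by
  rw [Nat.add_choose_eq, ← Finset.add_sum_erase _ _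
    (Finset.HasAntidiagonal.mem_antidiagonal.mpr (add_zero j) : (j, 0) ∈ Finset.HasAntidiagonal.antidiagonal j)]
  have h0 : m ∣ ∑ ij ∈ (Finset.HasAntidiagonal.antidiagonal j).erase (j, 0), u.choose ij.1 * N.choose ij.2 := by
    refine Finset.dvd_sum fun ij hij => ?_
    obtain ⟨a, b⟩ := ij
    simp only [Finset.mem_erase, Finset.HasAntidiagonal.mem_antidiagonal, ne_eq, Prod.mk.injEq, not_and] at hij
    exact (h b (Nat.pos_of_ne_zero fun hb => hij.1 (by omega) hb) (by omega)).mul_left _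
  simpa using (Nat.modEq_zero_iff_dvd.mpr h0).add_left (u.choose j)

/-! ### The non-classical polynomial and its agreement -/

/-- The weights `u` at which `e₁₂ / 8` agrees with `e₁₆ / 2` modulo `1`. -/
def IsAgreementWeight (u : ℕ) : Prop := u.choose 12 % 8 = 4 * (u.choose 16 % 2)

instance : DecidablePred IsAgreementWeight :=
  fun u => inferInstanceAs (Decidable (u.choose 12 % 8 = 4 * (u.choose 16 % 2)))

/-- For 1 ≤ i < 64 the 2-adic valuation of C(64, i) is 6 - v₂(i): at least 3 for i ≤ 12, at least 2
for i ≤ 16. -/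
theorem isAgreementWeight_periodic : Function.Periodic IsAgreementWeight 64 := by
  intro u
  have h₁ : (u + 64).choose 12 % 8 = u.choose 12 % 8 :=
    choose_add_modEq_of_dvd (fun i h₁ h₂ => by interval_cases i <;> decide +kernel) u
  have h₂ : (u + 64).choose 16 % 2 = u.choose 16 % 2 :=
    choose_add_modEq_of_dvd (fun i h₁ h₂ => by interval_cases i <;> decide +kernel) u
  unfold IsAgreementWeight
  rw [h₁, h₂]

/-- The decisive count: 36 exceeds half of 64. Falling factorials keep the kernel evaluation cheap.
-/
theorem count_isAgreementWeight : Nat.count IsAgreementWeight 64 = 36 := by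
  have h : ∀ u, IsAgreementWeight u ↔
      u.descFactorial 12 / Nat.factorial 12 % 8 =
        4 * (u.descFactorial 16 / Nat.factorial 16 % 2) := fun u => by
    rw [IsAgreementWeight, Nat.choose_eq_descFactorial_div_factorial,
      Nat.choose_eq_descFactorial_div_factorial]
  rw [Nat.count_eq_card_filter_range, Finset.filter_congr fun u _ => h u]
  decide +kernel

/-- The non-classical polynomial `e_D / 8`, where `e_D` is the elementary symmetric polynomial of
degree `D` with integer coefficients. -/
def eighthElemSym (n D : ℕ) (hD : 0 < D) : NonclassicalPolynomial n where
  shift := 0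
  terms := (Finset.univ.powersetCard D).product {3}
  nonempty_of_mem := fun t ht => by
    have h := (Finset.mem_powersetCard.mp (Finset.mem_product.mp ht).1).2
    exact Finset.card_pos.mp (by omega)
  one_le_of_mem := fun t ht => by
    rw [Finset.mem_singleton.mp (Finset.mem_product.mp ht).2]
    norm_num

theorem eighthElemSym_hasDyadicShift (n D : ℕ) (hD : 0 < D) :
    (eighthElemSym n D hD).HasDyadicShift :=
  ⟨0, by positivity, by simp [eighthElemSym]⟩

theorem eighthElemSym_degree_le (n D : ℕ) (hD : 0 < D) :
    (eighthElemSym n D hD).degree ≤ D + 2 := by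
  refine Finset.sup_le fun t ht => ?_
  have h₁ := (Finset.mem_powersetCard.mp (Finset.mem_product.mp ht).1).2
  have h₂ := Finset.mem_singleton.mp (Finset.mem_product.mp ht).2
  rw [h₁, h₂]

theorem eighthElemSym_eval_indicatorPoint {n D : ℕ} (hD : 0 < D) (X : Finset (Fin n)) :
    (eighthElemSym n D hD).eval (indicatorPoint X) =
      (((X.card.choose D : ℝ) / 8 : ℝ) : UnitAddCircle) := by
  have hsum : ∑ S ∈ (Finset.univ : Finset (Fin n)).powersetCard D,
      (if S ⊆ X then (1 : ℝ) else 0) / 2 ^ 3 = (X.card.choose D : ℝ) / 8 := by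
    rw [← Finset.sum_div, Finset.sum_boole]
    norm_num
    rw [← Finset.card_powersetCard]
    refine congrArg Finset.card ?_
    ext S
    simp only [Finset.mem_filter, Finset.mem_powersetCard, Finset.subset_univ, true_and]
    exact and_comm
  have hcoe := map_sum (QuotientAddGroup.mk' (AddSubgroup.zmultiples (1 : ℝ)))
    (fun S : Finset (Fin n) => (if S ⊆ X then (1 : ℝ) else 0) / 2 ^ 3)
    (Finset.univ.powersetCard D)
  rw [hsum] at hcoe
  unfold NonclassicalPolynomial.eval
  simp only [prod_val_indicatorPoint]
  refine Eq.trans ?_ hcoe.symm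
  simp only [eighthElemSym, zero_add]
  refine (Finset.sum_product _ _ _).trans ?_
  simp only [Finset.sum_singleton]
  rfl

theorem elemSym_eq_eighthElemSym {n ℓ : ℕ} (hℓ : 4 ≤ ℓ) (hD : 0 < 2 ^ (ℓ - 4) * 12)
    (X : Finset (Fin n)) (hX : IsAgreementWeight (X.card / 2 ^ (ℓ - 4))) :
    elemSym n (2 ^ ℓ) (indicatorPoint X) =
      (eighthElemSym n (2 ^ (ℓ - 4) * 12) hD).eval (indicatorPoint X) := by
  have h₁ : X.card.choose (2 ^ (ℓ - 4) * 12) % 8 = (X.card / 2 ^ (ℓ - 4)).choose 12 % 8 :=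
    choose_two_pow_mul_modEq (ℓ - 4) X.card (by norm_num)
  have h₂ : X.card.choose (2 ^ (ℓ - 4) * 16) % 8 = (X.card / 2 ^ (ℓ - 4)).choose 16 % 8 :=
    choose_two_pow_mul_modEq (ℓ - 4) X.card (by norm_num)
  have hpow : 2 ^ (ℓ - 4) * 16 = 2 ^ ℓ := by
    rw [show (16 : ℕ) = 2 ^ 4 by norm_num, ← pow_add, Nat.sub_add_cancel hℓ]
  rw [hpow] at h₂
  unfold IsAgreementWeight at hX
  rw [elemSym_indicatorPoint, eighthElemSym_eval_indicatorPoint, toTorus_natCast]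
  set A := X.card.choose (2 ^ ℓ)
  set B := X.card.choose (2 ^ (ℓ - 4) * 12)
  -- A/2 and B/8 agree modulo 1 as soon as 8 divides 4A - B.
  obtain ⟨c, hc⟩ : ∃ c : ℤ, (4 * A : ℤ) - B = 8 * c := ⟨((4 * A : ℤ) - B) / 8, by omega⟩
  have hc' : (4 * A : ℝ) - B = 8 * c := by exact_mod_cast hc
  rw [← sub_eq_zero, ← AddCircle.coe_sub, AddCircle.coe_eq_zero_iff]
  refine ⟨c, ?_⟩
  rw [zsmul_eq_mul, mul_one]
  linarith

theorem eventually_agr_eighthElemSym_ge {ℓ : ℕ} (hℓ : 4 ≤ ℓ) (hD : 0 < 2 ^ (ℓ - 4) * 12) :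
    ∀ᶠ n : ℕ in atTop, 1 / 2 + 1 / 32 ≤
      agr (elemSym n (2 ^ ℓ)) (eighthElemSym n (2 ^ (ℓ - 4) * 12) hD).eval := by
  classical
  set b : ℕ := 2 ^ (ℓ - 4)
  have hbpos : 0 < b := by positivity
  set φ : ℕ → ℝ := fun w => if IsAgreementWeight (w / b) then 1 else 0 with hφ
  have hφ1 : ∀ m, |φ m| ≤ 1 := fun m => by simp only [hφ]; split_ifs <;> simp
  -- Shifting w by b·j moves ⌊w/b⌋ by exactly j, so 64 such shifts run through one full period.
  have hperiod : ∀ w, ∑ j ∈ Finset.range 64, φ (w + b * j) = 36 := by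
    intro w
    have h : ∀ j ∈ Finset.range 64, φ (w + b * j) =
        if IsAgreementWeight (w / b + j) then 1 else 0 := fun j _ => by
      simp only [hφ, Nat.add_mul_div_left w j hbpos]
    have hcount := Nat.filter_Ico_card_eq_of_periodic (w / b) 64 IsAgreementWeight
      isAgreementWeight_periodic
    rw [count_isAgreementWeight] at hcount
    have hIco := Finset.sum_Ico_eq_sum_range
      (fun u => if IsAgreementWeight u then (1 : ℝ) else 0) (w / b) (w / b + 64)
    rw [Nat.add_sub_cancel_left] at hIco
    rw [Finset.sum_congr rfl h, ← hIco, Finset.sum_boole, hcount]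
    norm_num
  have hlim := tendsto_two_div_sqrt.const_mul ((64 : ℝ) * b)
  rw [mul_zero] at hlim
  -- Of the advantage 36/64 - 1/2 = 1/16, half is given up to the error of the shifts, all at most
  -- 64b.
  filter_upwards [hlim.eventually (ge_mem_nhds (show (0 : ℝ) < 1 / 32 by norm_num))] with n hn
  set Ω := (Finset.univ : Finset (Fin n)).powerset
  set T : ℝ := ∑ X ∈ Ω, φ X.card
  have hdiff : ∀ j ∈ Finset.range 64, ∑ X ∈ Ω, φ (X.card + b * j) ≤ T + 1 / 32 * 2 ^ n := by
    intro j hj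
    have h := (le_abs_self _).trans
      (abs_sum_powerset_shift_sub_le (Finset.univ : Finset (Fin n)) φ hφ1 (b * j))
    rw [Finset.sum_sub_distrib, Finset.card_fin] at h
    have hj' : (j : ℝ) ≤ 64 := by exact_mod_cast (Finset.mem_range.mp hj).le
    have h2 : ((b * j : ℕ) : ℝ) * (2 / √(n + 1) * 2 ^ n) ≤ 1 / 32 * 2 ^ n := by
      rw [← mul_assoc]
      refine mul_le_mul_of_nonneg_right (le_trans ?_ hn) (by positivity)
      refine mul_le_mul_of_nonneg_right ?_ (by positivity)
      push_cast
      nlinarith [(Nat.cast_nonneg b : (0 : ℝ) ≤ b)]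
    linarith
  have htotal : (36 : ℝ) * 2 ^ n ≤ 64 * (T + 1 / 32 * 2 ^ n) := by
    calc (36 : ℝ) * 2 ^ n = ∑ X ∈ Ω, ∑ j ∈ Finset.range 64, φ (X.card + b * j) := by
          simp only [hperiod, Finset.sum_const, nsmul_eq_mul, Ω, Finset.card_powerset,
            Finset.card_fin]
          push_cast
          ring
      _ = ∑ j ∈ Finset.range 64, ∑ X ∈ Ω, φ (X.card + b * j) := Finset.sum_comm
      _ ≤ ∑ j ∈ Finset.range 64, (T + 1 / 32 * 2 ^ n) := Finset.sum_le_sum hdiff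
      _ = 64 * (T + 1 / 32 * 2 ^ n) := by
          rw [Finset.sum_const, Finset.card_range, nsmul_eq_mul]
          norm_num
  have hle : T ≤ ∑ X ∈ Ω, if elemSym n (2 ^ ℓ) (indicatorPoint X) =
      (eighthElemSym n (b * 12) hD).eval (indicatorPoint X) then (1 : ℝ) else 0 := by
    refine Finset.sum_le_sum fun X _ => ?_
    simp only [hφ]
    by_cases h : IsAgreementWeight (X.card / b)
    · rw [if_pos h, if_pos (elemSym_eq_eighthElemSym hℓ hD X h)]
    · rw [if_neg h]
      split_ifs <;> norm_num
  rw [agr_eq_sum_powerset, le_div_iff₀ (by positivity)]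
  linarith

theorem mainTheorem4 (ℓ : ℕ) (hℓ : 4 ≤ ℓ) :
    ∃ d : ℕ, 1 ≤ d ∧
      (∃ ε : ℕ → ℝ, Tendsto ε atTop (𝓝 0) ∧
        ∀ n : ℕ, 1 ≤ n → ∀ P : NonclassicalPolynomial n, P.IsClassical → P.degree ≤ d →
          agr (elemSym n (2 ^ ℓ)) P.eval ≤ 1 / 2 + ε n) ∧
      (∃ c : ℝ, 0 < c ∧ ∀ᶠ n : ℕ in atTop,
        ∃ P : NonclassicalPolynomial n, P.HasDyadicShift ∧ P.degree ≤ d ∧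
          1 / 2 + c ≤ agr (elemSym n (2 ^ ℓ)) P.eval) := by
  have hpos : 0 < 2 ^ (ℓ - 4) := by positivity
  have hpow : 2 ^ (ℓ - 4) * 16 = 2 ^ ℓ := by
    rw [show (16 : ℕ) = 2 ^ 4 by norm_num, ← pow_add, Nat.sub_add_cancel hℓ]
  have hD : 0 < 2 ^ (ℓ - 4) * 12 := by omega
  -- The extra 2 is the cost of depth 3. The classical bound needs 12b + 2 < 16b, which holds
  -- already for b = 1.
  refine ⟨2 ^ (ℓ - 4) * 12 + 2, by omega, exists_tendsto_zero_classical ℓ _ (by omega),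
    1 / 32, by norm_num, ?_⟩
  filter_upwards [eventually_agr_eighthElemSym_ge hℓ hD] with n hn
  exact ⟨eighthElemSym n _ hD, eighthElemSym_hasDyadicShift n _ hD,
    eighthElemSym_degree_le n _ hD, hn⟩
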